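/- All spaces are Hausdorff. Set-valued mappings $\psi:X\rightsquigarrow Y$ assign to each $x\in X$ a nonempty subset $\psi(x)\subset Y$; such a $\psi$ is *lower locally constant* if $\{x\in X: K\subset\psi(x)\}$ is open in $X$ for every compact $K\subset Y$. For $k\ge 0$ and $S,B\subset Y$ write $S\hookrightarrow_k B$ if every continuous map of the $k$-sphere $\mathbb S^k$ into $S$ extends to a continuous map of the $(k+1)$-ball $\mathbb B^{k+1}$ into $B$. For a normal space $X$, $\dim(X)\le n$ means that every finite open cover of $X$ has an open refinement covering $X$ in which no $n+2$ distinct members have a common point. For a metric space $(Y,d)$ put $\mathbf O_\varepsilon(y)=\{z\in Y:d(z,y)<\varepsilon\}$ and $\mathbf O_\varepsilon(S)=\bigcup_{y\in S}\mathbf O_\varepsilon(y)$; a map $g:X\to Y$ is a *selection* for $\psi$ if $g(x)\in\psi(x)$ for all $x\in X$, and an *$\varepsilon$-selection* for $\psi$ if $g(x)\in\mathbf O_\varepsilon(\psi(x))$ for all $x\in X$. For a function $\delta:(0,+\infty)\to(0,+\infty)$ let $\delta_0(\varepsilon)=\varepsilon$ and $\delta_{m+1}(\varepsilon)=\delta(\delta_m(\varepsilon))$.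 **Theorem.** Let $n\ge 0$, let $(Y,d)$ be a metric space, $X$ a paracompact space with $\dim(X)\le n$, $\delta:(0,+\infty)\to(0,+\infty)$ an arbitrary function, and $\psi_k:X\rightsquigarrow Y$, $0\le k\le n$, lower locally constant mappings such that $$\mathbf O_{\delta(\varepsilon)}(y)\cap\psi_k(x)\ \hookrightarrow_k\ \mathbf O_{\varepsilon}(y)\cap\psi_{k+1}(x)\qquad\text{for all } \varepsilon>0,\ x\in X,\ y\in Y \text{ and } 0\le k<n.$$ Then for every $\varepsilon>0$ and every continuous $\delta_n(\varepsilon)$-selection $g:X\to Y$ for $\psi_0$ there is a continuous selection $f:X\to Y$ for $\psi_n$ such that $d(f(x),g(x))<\varepsilon$ for all $x\in X$. -/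

import Mathlib

/-- Covering dimension `dim X ≤ n`: every finite open cover `𝒰` of `X` has an open refinement `𝒱`
(again a cover of `X`) of order at most `n`, i.e. no `n + 2` distinct members of `𝒱` have a
common point. -/
def CoveringDimLE (X : Type*) [TopologicalSpace X] (n : ℕ) : Prop :=
  ∀ 𝒰 : Set (Set X), 𝒰.Finite → (∀ U ∈ 𝒰, IsOpen U) → ⋃₀ 𝒰 = Set.univ →
    ∃ 𝒱 : Set (Set X), (∀ V ∈ 𝒱, IsOpen V) ∧ ⋃₀ 𝒱 = Set.univ ∧
      (∀ V ∈ 𝒱, ∃ U ∈ 𝒰, V ⊆ U) ∧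
      ∀ σ : Finset (Set X), (σ : Set (Set X)) ⊆ 𝒱 → n + 2 ≤ σ.card →
        ⋂₀ (σ : Set (Set X)) = ∅

/-- A set-valued mapping `φ` is lower locally constant if `{x | K ⊆ φ x}` is open for every
compact `K`. -/
def LowerLocallyConstant {X Y : Type*} [TopologicalSpace X] [TopologicalSpace Y]
    (φ : X → Set Y) : Prop :=
  ∀ K : Set Y, IsCompact K → IsOpen {x : X | K ⊆ φ x}

/-- The relation `S ↪ₖ B`: every continuous map of the `k`-sphere into `S` extends to a
continuous map of the `(k+1)`-ball into `B`. -/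
def SphereExtends {Y : Type*} [TopologicalSpace Y] (k : ℕ) (S B : Set Y) : Prop :=
  ∀ g : C(Metric.sphere (0 : EuclideanSpace ℝ (Fin (k + 1))) 1, Y), (∀ p, g p ∈ S) →
    ∃ h : C(Metric.closedBall (0 : EuclideanSpace ℝ (Fin (k + 1))) 1, Y),
      (∀ p, h p ∈ B) ∧
      ∀ p : Metric.sphere (0 : EuclideanSpace ℝ (Fin (k + 1))) 1,
        h ⟨p.1, Metric.sphere_subset_closedBall p.2⟩ = g p

/-- `f` is a selection for the set-valued mapping `φ`. -/
def IsSelection {X Y : Type*} (f : X → Y) (φ : X → Set Y) : Prop :=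
  ∀ x, f x ∈ φ x

/-- `f` is an `ε`-selection for `φ`: each `f x` lies in the union of the open `ε`-balls centred at
the points of `φ x`. -/
def IsApproxSelection {X Y : Type*} [PseudoMetricSpace Y] (ε : ℝ) (f : X → Y)
    (φ : X → Set Y) : Prop :=
  ∀ x, f x ∈ ⋃ y ∈ φ x, Metric.ball y ε

/-!
Intersecting the values of `ψ k` with balls centred at `g x`, namely
`φ k x = ball (g x) (δ^[n - k] ε) ∩ ψ k x`, one gets lower locally constant mappings with `φ 0`
nonempty-valued and `φ k x ↪ₖ φ (k + 1) x`, and a selection for `φ n` is what is wanted. So the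
metric of `Y` disappears from the problem (`CoveringDimLE.exists_selection`).

A selection for `φ n` is obtained as a composition `X → |nerve| → Y`. Covers of levels `0, …, n` are
built one after the other (`IsNerveSelection`), along with a map `h` on the complex whose simplices
have at most one vertex on each level, such that a simplex of dimension `j` goes into `φ j x` for
every common point `x` of its members. In the step from one level to the next
(`IsNerveSelection.exists_succ`), each point `x` becomes the apex of a cone over the finite complex
of the simplices at `x`. Skeleton by skeleton, the relations `φ j x ↪ⱼ φ (j + 1) x` extend `h` over
the cone (`exists_extension_skeleta`). The cone has finitely many simplices, with compact images, so
by lower local constancy the same cone serves for all points of a neighbourhood of `x`. The next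
cover is a locally finite closed refinement of these neighbourhoods.

Since all simplices have at most one vertex on each level, their dimension is at most `n`, and `h` is
needed on no others: in a paracompact space of dimension at most `n`, any `n + 1` open covers
are refined by `n + 1` disjoint families which cover the space together
(`CoveringDimLE.exists_disjoint_refinements`). A partition of unity subordinate to the unions of
these families maps `X` to the complex. The disjoint families rest on Dowker's theorem that the
dimension, defined by finite covers, controls locally finite covers
(`CoveringDimLE.exists_shrinking_of_locallyFinite`).
-/

/-! ### Covering dimension and locally finite covers -/

/-- Covering dimension for indexed finite covers: the refinement can be taken to be a shrinking. -/
theorem CoveringDimLE.exists_shrinking_of_finite {X κ : Type*} [TopologicalSpace X] [Finite κ]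
    {n : ℕ} (hX : CoveringDimLE X n) {W : κ → Set X} (hWo : ∀ i, IsOpen (W i))
    (hW : ⋃ i, W i = Set.univ) :
    ∃ V : κ → Set X, (∀ i, IsOpen (V i)) ∧ ⋃ i, V i = Set.univ ∧ (∀ i, V i ⊆ W i) ∧
      ∀ T : Finset κ, n + 2 ≤ T.card → ⋂ i ∈ T, V i = ∅ := by
  classical
  obtain ⟨𝒱, h𝒱o, h𝒱, hr, hord⟩ := hX (Set.range W) (Set.finite_range W)
    (by rintro _ ⟨i, rfl⟩; exact hWo i) (by rw [Set.sUnion_range, hW])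
  have hr' : ∀ V : 𝒱, ∃ i, V.1 ⊆ W i := fun V => by
    obtain ⟨_, ⟨i, rfl⟩, hi⟩ := hr V.1 V.2
    exact ⟨i, hi⟩
  choose r hrW using hr'
  refine ⟨fun i => ⋃ V : {V : 𝒱 // r V = i}, V.1.1, fun i => isOpen_iUnion fun V => h𝒱o _ V.1.2,
    ?_, fun i => Set.iUnion_subset fun ⟨V, hV⟩ => hV ▸ hrW V, fun T hT => ?_⟩
  · refine Set.eq_univ_of_forall fun x => ?_
    obtain ⟨V, hV, hx⟩ := (h𝒱.symm ▸ Set.mem_univ x : x ∈ ⋃₀ 𝒱)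
    exact Set.mem_iUnion.2 ⟨r ⟨V, hV⟩, Set.mem_iUnion.2 ⟨⟨⟨V, hV⟩, rfl⟩, hx⟩⟩
  · refine Set.eq_empty_of_forall_notMem fun x hx => ?_
    have hx' : ∀ i : T, ∃ V : 𝒱, r V = i ∧ x ∈ V.1 := fun i => by
      obtain ⟨V, hV⟩ := Set.mem_iUnion.1 (Set.mem_iInter₂.1 hx i i.2)
      exact ⟨V.1, V.2, hV⟩
    choose v hvr hxv using hx'
    have hinj : Function.Injective fun i : T => (v i).1 := fun i j hij => by
      have : v i = v j := Subtype.ext hij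
      exact Subtype.ext (by rw [← hvr i, ← hvr j, this])
    have := hord (Finset.univ.image fun i : T => (v i).1)
      (by intro V hV
          obtain ⟨i, -, rfl⟩ := Finset.mem_image.1 (Finset.mem_coe.1 hV)
          exact (v i).2)
      (by rw [Finset.card_image_of_injective _ hinj]; simpa using hT)
    refine (this ▸ Set.notMem_empty x : x ∉ _) ?_
    rintro V hV
    obtain ⟨i, -, rfl⟩ := Finset.mem_image.1 (Finset.mem_coe.1 hV)
    exact hxv i

/-- **Dowker's theorem**: covering dimension, defined by finite covers, controls locally finite
covers. One removes the common points of the members indexed by `T`, for each `T` with `n + 2`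
elements; this changes the cover only inside the closure of `⋂ i ∈ T, U i`. These closures form a
locally finite family, so that infinitely many modifications can be made in succession, which Zorn's
lemma organises: its elements are the pairs of the set of those `T` already treated and the cover
reached. -/
theorem CoveringDimLE.exists_shrinking_of_locallyFinite {X ι : Type*} [TopologicalSpace X]
    {n : ℕ} (hX : CoveringDimLE X n) {U : ι → Set X} (hUo : ∀ i, IsOpen (U i))
    (hU : ⋃ i, U i = Set.univ) (hUf : LocallyFinite U) :
    ∃ V : ι → Set X, (∀ i, IsOpen (V i)) ∧ ⋃ i, V i = Set.univ ∧ (∀ i, V i ⊆ U i) ∧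
      ∀ T : Finset ι, T.card = n + 2 → ⋂ i ∈ T, V i = ∅ := by
  classical
  let C : Finset ι → Set X := fun T => closure (⋂ i ∈ T, U i)
  -- Finitely many `C T` meet a suitable neighbourhood of a given point.
  have hCf : ∀ x, ∃ O : Set X, IsOpen O ∧ x ∈ O ∧
      {T : Finset ι | T.card = n + 2 ∧ (O ∩ C T).Nonempty}.Finite := fun x => by
    obtain ⟨N, hN, hNf⟩ := hUf x
    obtain ⟨O, hON, hO, hxO⟩ := mem_nhds_iff.1 hN
    refine ⟨O, hO, hxO, (Finset.finite_toSet hNf.toFinset.powerset).subset ?_⟩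
    rintro T ⟨-, y, hyO, hy⟩
    obtain ⟨z, hzO, hz⟩ := mem_closure_iff.1 hy O hO hyO
    refine Finset.mem_coe.2 (Finset.mem_powerset.2 fun i hi => hNf.mem_toFinset.2 ?_)
    exact ⟨z, Set.mem_iInter₂.1 hz i hi, hON hzO⟩
  let Good : Set (Set (Finset ι) × (ι → Set X)) := {p | (∀ i, IsOpen (p.2 i)) ∧
    ⋃ i, p.2 i = Set.univ ∧ (∀ i, p.2 i ⊆ U i) ∧
    ∀ T ∈ p.1, T.card = n + 2 ∧ ⋂ i ∈ T, p.2 i = ∅}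
  let r : Good → Good → Prop := fun p q => p.1.1 ⊆ q.1.1 ∧ (∀ i, q.1.2 i ⊆ p.1.2 i) ∧
    ∀ i x, x ∈ p.1.2 i → x ∉ q.1.2 i → ∃ T ∈ q.1.1, T ∉ p.1.1 ∧ x ∈ C T
  have hrtrans : ∀ {a b c}, r a b → r b c → r a c := by
    rintro a b c ⟨h1, h2, h3⟩ ⟨k1, k2, k3⟩
    refine ⟨h1.trans k1, fun i => (k2 i).trans (h2 i), fun i x hxa hxc => ?_⟩
    by_cases hxb : x ∈ b.1.2 i
    · obtain ⟨T, hT, hT', hx⟩ := k3 i x hxb hxc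
      exact ⟨T, hT, fun h => hT' (h1 h), hx⟩
    · obtain ⟨T, hT, hT', hx⟩ := h3 i x hxa hxb
      exact ⟨T, k1 hT, hT', hx⟩
  have hrrefl : ∀ a, r a a := fun a =>
    ⟨subset_rfl, fun i => subset_rfl, fun i x h h' => (h' h).elim⟩
  have hchain : ∀ c : Set Good, IsChain r c → ∃ ub, ∀ a ∈ c, r a ub := by
    intro c hc
    rcases c.eq_empty_or_nonempty with rfl | hne
    · exact ⟨⟨(∅, U), hUo, hU, fun i => subset_rfl, by simp⟩, by simp⟩
    have htot : ∀ a ∈ c, ∀ b ∈ c, r a b ∨ r b a := fun a ha b hb => by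
      by_cases hab : a = b
      · exact Or.inl (hab ▸ hrrefl a)
      · exact hc ha hb hab
    -- Near each point the chain is eventually constant.
    have hstat : ∀ x, ∃ O : Set X, IsOpen O ∧ x ∈ O ∧ ∃ p ∈ c, ∀ q ∈ c, ∀ i,
        p.1.2 i ∩ O ⊆ q.1.2 i := fun x => by
      obtain ⟨O, hO, hxO, hfin⟩ := hCf x
      have hdir : DirectedOn (fun a b : Good => a.1.1 ⊆ b.1.1) c := fun a ha b hb => by
        rcases htot a ha b hb with h | h
        · exact ⟨b, hb, h.1, subset_rfl⟩
        · exact ⟨a, ha, subset_rfl, h.1⟩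
      have hfin' : ({T : Finset ι | T.card = n + 2 ∧ (O ∩ C T).Nonempty} ∩
          ⋃ a ∈ c, a.1.1).Finite := hfin.subset Set.inter_subset_left
      obtain ⟨p, hp, hpsub⟩ : ∃ p ∈ c, {T : Finset ι | T.card = n + 2 ∧ (O ∩ C T).Nonempty} ∩
          ⋃ a ∈ c, a.1.1 ⊆ p.1.1 := by
        have := DirectedOn.exists_mem_subset_of_finset_subset_biUnion hne hdir
          (s := hfin'.toFinset) (by rw [hfin'.coe_toFinset]; exact Set.inter_subset_right)
        rwa [hfin'.coe_toFinset] at this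
      refine ⟨O, hO, hxO, p, hp, fun q hq i y hy => ?_⟩
      rcases htot p hp q hq with h | h
      · by_contra hyq
        obtain ⟨T, hT, hT', hyT⟩ := h.2.2 i y hy.1 hyq
        exact hT' (hpsub ⟨⟨(q.2.2.2.2 T hT).1, y, hy.2, hyT⟩, Set.mem_biUnion hq hT⟩)
      · exact h.2.1 i hy.1
    refine ⟨⟨(⋃ a ∈ c, a.1.1, fun i => ⋂ a ∈ c, a.1.2 i), fun i => ?_, ?_, fun i => ?_, ?_⟩, ?_⟩
    · refine isOpen_iff_mem_nhds.2 fun x hx => ?_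
      obtain ⟨O, hO, hxO, p, hp, h⟩ := hstat x
      exact Filter.mem_of_superset
        (((p.2.1 i).inter hO).mem_nhds ⟨Set.mem_iInter₂.1 hx p hp, hxO⟩)
        (fun y hy => Set.mem_iInter₂.2 fun q hq => h q hq i hy)
    · refine Set.eq_univ_of_forall fun x => ?_
      obtain ⟨O, hO, hxO, p, hp, h⟩ := hstat x
      obtain ⟨i, hi⟩ := Set.mem_iUnion.1 (p.2.2.1.symm ▸ Set.mem_univ x : x ∈ ⋃ i, p.1.2 i)
      exact Set.mem_iUnion.2 ⟨i, Set.mem_iInter₂.2 fun q hq => h q hq i ⟨hi, hxO⟩⟩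
    · obtain ⟨p, hp⟩ := hne
      exact (Set.biInter_subset_of_mem hp).trans (p.2.2.2.1 i)
    · intro T hT
      obtain ⟨p, hp, hT⟩ := Set.mem_iUnion₂.1 hT
      refine ⟨(p.2.2.2.2 T hT).1, Set.eq_empty_of_forall_notMem fun x hx => ?_⟩
      refine ((p.2.2.2.2 T hT).2 ▸ Set.notMem_empty x : x ∉ _) ?_
      exact Set.mem_iInter₂.2 fun i hi =>
        Set.mem_iInter₂.1 (Set.mem_iInter₂.1 hx i hi) p hp
    · intro q hq
      refine ⟨Set.subset_biUnion_of_mem (u := fun a : Good => a.1.1) hq,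
        fun i => Set.biInter_subset_of_mem hq, fun i x hxq hx => ?_⟩
      obtain ⟨p, hp, hxp⟩ : ∃ p ∈ c, x ∉ p.1.2 i := by
        simpa using hx
      rcases htot q hq p hp with h | h
      · obtain ⟨T, hT, hT', hxT⟩ := h.2.2 i x hxq hxp
        exact ⟨T, Set.mem_biUnion hp hT, hT', hxT⟩
      · exact (hxp (h.2.1 i hxq)).elim
  obtain ⟨⟨⟨𝒯, V⟩, hVo, hV, hVU, hV𝒯⟩, hmax⟩ := exists_maximal_of_chains_bounded hchain hrtrans
  refine ⟨V, hVo, hV, hVU, fun T hT => ?_⟩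
  by_contra hTne
  have hT𝒯 : T ∉ 𝒯 := fun h => hTne (hV𝒯 T h).2
  -- The members outside `T` are lumped together, so that a finite cover remains.
  let W : Option T → Set X := fun o => o.elim (⋃ i : {i // i ∉ T}, V i) fun i => V i
  obtain ⟨W', hWo', hW', hWW', hord⟩ := hX.exists_shrinking_of_finite (W := W)
    (by
      rintro (_ | i)
      · exact isOpen_iUnion fun i => hVo i
      · exact hVo i)
    (by
      refine Set.eq_univ_of_forall fun x => ?_
      obtain ⟨i, hi⟩ := Set.mem_iUnion.1 (hV.symm ▸ Set.mem_univ x : x ∈ ⋃ i, V i)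
      by_cases hiT : i ∈ T
      · exact Set.mem_iUnion.2 ⟨some ⟨i, hiT⟩, hi⟩
      · exact Set.mem_iUnion.2 ⟨none, Set.mem_iUnion.2 ⟨⟨i, hiT⟩, hi⟩⟩)
  let V' : ι → Set X := fun i => if h : i ∈ T then W' (some ⟨i, h⟩) ∪ (V i \ C T) else V i
  have hV'V : ∀ i, V' i ⊆ V i := fun i => by
    by_cases h : i ∈ T
    · simp only [V', h, dif_pos]
      exact Set.union_subset (hWW' (some ⟨i, h⟩)) Set.sdiff_subset
    · simp [V', h]
  have hV'T : ⋂ i ∈ T, V' i = ∅ := by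
    refine Set.eq_empty_of_forall_notMem fun x hx => ?_
    have hx' : ∀ i ∈ T, x ∈ V' i := fun i hi => Set.mem_iInter₂.1 hx i hi
    have hxC : x ∈ C T := subset_closure
      (Set.mem_iInter₂.2 fun i hi => hVU i (hV'V i (hx' i hi)))
    have hempty := hord (Finset.univ.image some) ?_
    · refine (hempty ▸ Set.notMem_empty x : x ∉ _) ?_
      refine Set.mem_iInter₂.2 fun o ho => ?_
      obtain ⟨⟨i, hi⟩, -, rfl⟩ := Finset.mem_image.1 ho
      have := hx' i hi
      simp only [V', hi, dif_pos] at this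
      exact this.resolve_right fun h => h.2 hxC
    · rw [Finset.card_image_of_injective _ (Option.some_injective _)]
      simp [hT]
  have hgood : (insert T 𝒯, V') ∈ Good := by
    refine ⟨fun i => ?_, Set.eq_univ_of_forall fun x => ?_, fun i => (hV'V i).trans (hVU i), ?_⟩
    · by_cases h : i ∈ T
      · simp only [V', h, dif_pos]
        exact (hWo' _).union ((hVo i).sdiff isClosed_closure)
      · simpa [V', h] using hVo i
    · obtain ⟨o, ho⟩ := Set.mem_iUnion.1 (hW'.symm ▸ Set.mem_univ x : x ∈ ⋃ i, W' i)
      rcases o with _ | ⟨i, hi⟩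
      · obtain ⟨⟨i, hi⟩, hx⟩ := Set.mem_iUnion.1 (hWW' none ho)
        exact Set.mem_iUnion.2 ⟨i, by simpa [V', hi] using hx⟩
      · exact Set.mem_iUnion.2 ⟨i, by simp only [V', hi, dif_pos]; exact Or.inl ho⟩
    · rintro S (rfl | hS)
      · exact ⟨hT, hV'T⟩
      · refine ⟨(hV𝒯 S hS).1, Set.subset_empty_iff.1 ?_⟩
        rw [← (hV𝒯 S hS).2]
        exact Set.iInter₂_mono fun i _ => hV'V i
  refine hT𝒯 ((hmax ⟨_, hgood⟩ ⟨Set.subset_insert _ _, hV'V, fun i x hx hx' => ?_⟩).1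
    (Set.mem_insert _ _))
  refine ⟨T, Set.mem_insert _ _, hT𝒯, ?_⟩
  by_contra hxC
  refine hx' ?_
  by_cases h : i ∈ T
  · simp only [V', h, dif_pos]
    exact Or.inr ⟨hx, hxC⟩
  · simpa [V', h] using hx

/-- A paracompact space of dimension at most `n` has the selection property of a finite `C`-space:
any `n + 1` open covers are refined by `n + 1` disjoint open families which cover the space
together. The families come from a partition of unity `ρ` subordinate to a common refinement of
order at most `n`: the `i`-th family consists of the sets on which `i + 1` given members of `ρ`
exceed all the others. -/
theorem CoveringDimLE.exists_disjoint_refinements {X ι : Type*} [TopologicalSpace X] [T2Space X]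
    [ParacompactSpace X] {n : ℕ} (hX : CoveringDimLE X n) {U : Fin (n + 1) → ι → Set X}
    (hUo : ∀ i s, IsOpen (U i s)) (hU : ∀ i, ⋃ s, U i s = Set.univ) :
    ∃ V : Fin (n + 1) → ι → Set X, (∀ i s, IsOpen (V i s)) ∧ (∀ i s, V i s ⊆ U i s) ∧
      (∀ i, Pairwise fun s t => Disjoint (V i s) (V i t)) ∧ ∀ x, ∃ i s, x ∈ V i s := by
  classical
  obtain ⟨V₀, hV₀o, hV₀, hV₀f, hV₀U⟩ := precise_refinement
    (fun c : Fin (n + 1) → ι => ⋂ i, U i (c i)) (fun c => isOpen_iInter_of_finite fun i => hUo i _)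
    (by
      refine Set.eq_univ_of_forall fun x => ?_
      have : ∀ i, ∃ s, x ∈ U i s := fun i =>
        Set.mem_iUnion.1 ((hU i).symm ▸ Set.mem_univ x : x ∈ ⋃ s, U i s)
      choose c hc using this
      exact Set.mem_iUnion.2 ⟨c, Set.mem_iInter.2 hc⟩)
  obtain ⟨V₁, hV₁o, hV₁, hV₁V, hord⟩ := hX.exists_shrinking_of_locallyFinite hV₀o hV₀ hV₀f
  obtain ⟨ρ, hρ⟩ := PartitionOfUnity.exists_isSubordinate isClosed_univ V₁ hV₁o hV₁.ge
  let G : Finset (Fin (n + 1) → ι) → Set X :=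
    fun σ => {x | ∀ c ∈ σ, 0 < ρ c x ∧ ∀ d ∉ σ, ρ d x < ρ c x}
  have hGo : ∀ σ, IsOpen (G σ) := fun σ => by
    refine isOpen_iff_mem_nhds.2 fun x hx => ?_
    obtain ⟨N, hN, hNf⟩ := ρ.locallyFinite x
    have h1 : ∀ c ∈ σ, ∀ᶠ y in nhds x, 0 < ρ c y ∧ ∀ d ∈ hNf.toFinset, d ∉ σ → ρ d y < ρ c y := by
      intro c hc
      refine ((ρ c).continuous.continuousAt.eventually_const_lt (hx c hc).1).and ?_
      refine (Finset.eventually_all _).2 fun d _ => ?_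
      by_cases hd : d ∈ σ
      · exact Filter.Eventually.of_forall fun y h => (h hd).elim
      · filter_upwards [(ρ d).continuous.continuousAt.eventually_lt (ρ c).continuous.continuousAt
          ((hx c hc).2 d hd)] with y hy _ using hy
    filter_upwards [(Finset.eventually_all _).2 h1, hN] with y hy hyN
    refine fun c hc => ⟨(hy c hc).1, fun d hd => ?_⟩
    by_cases hd' : ρ d y = 0
    · rw [hd']; exact (hy c hc).1
    · exact (hy c hc).2 d (hNf.mem_toFinset.2 ⟨y, hd', hyN⟩) hd
  have hGdisj : ∀ σ τ, σ.card = τ.card → σ ≠ τ → ∀ x, x ∈ G σ → x ∉ G τ := by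
    intro σ τ hcard hne x hxσ hxτ
    have h1 : ¬ σ ⊆ τ := fun h => hne (Finset.eq_of_subset_of_card_le h hcard.ge)
    have h2 : ¬ τ ⊆ σ := fun h => hne (Finset.eq_of_subset_of_card_le h hcard.le).symm
    obtain ⟨c, hc, hc'⟩ := Finset.not_subset.1 h1
    obtain ⟨d, hd, hd'⟩ := Finset.not_subset.1 h2
    exact lt_asymm ((hxσ c hc).2 d hd') ((hxτ d hd).2 c hc')
  have hρV : ∀ c x, 0 < ρ c x → x ∈ V₁ c := fun c x h => hρ c (subset_tsupport _ h.ne')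
  refine ⟨fun i s => ⋃ σ : {σ : Finset (Fin (n + 1) → ι) //
      σ.card = i + 1 ∧ ∃ h : σ.Nonempty, h.choose i = s}, G σ,
    fun i s => isOpen_iUnion fun σ => hGo σ, fun i s => Set.iUnion_subset ?_, fun i s t hst => ?_,
    fun x => ?_⟩
  · rintro ⟨σ, -, h, rfl⟩
    intro x hx
    have hx' := hV₀U _ (hV₁V _ (hρV _ x (hx _ h.choose_spec).1))
    exact Set.mem_iInter.1 hx' i
  · refine Set.disjoint_left.2 fun x hx hx' => ?_
    obtain ⟨⟨σ, hσ, h, hs⟩, hxσ⟩ := Set.mem_iUnion.1 hx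
    obtain ⟨⟨τ, hτ, h', ht⟩, hxτ⟩ := Set.mem_iUnion.1 hx'
    have : σ = τ := by
      by_contra hne
      exact hGdisj σ τ (hσ.trans hτ.symm) hne x hxσ hxτ
    subst this
    exact hst (hs.symm.trans ht)
  · -- The members of `ρ` of maximal value at `x` span a set `G σ` containing `x`.
    obtain ⟨c₀, hc₀⟩ := ρ.exists_pos (Set.mem_univ x)
    have hfin : {c | 0 < ρ c x}.Finite :=
      (ρ.locallyFinite.point_finite x).subset fun c hc => hc.ne'
    obtain ⟨m, hm, hmax⟩ := hfin.toFinset.exists_max_image (fun c => ρ c x)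
      ⟨c₀, hfin.mem_toFinset.2 hc₀⟩
    have hm : 0 < ρ m x := hfin.mem_toFinset.1 hm
    have hmax : ∀ d, ρ d x ≤ ρ m x := fun d => by
      by_cases hd : 0 < ρ d x
      · exact hmax d (hfin.mem_toFinset.2 hd)
      · exact (not_lt.1 hd).trans hm.le
    let σ := hfin.toFinset.filter fun c => ρ c x = ρ m x
    have hσ : ∀ c, c ∈ σ ↔ ρ c x = ρ m x := fun c => by
      simp only [σ, Finset.mem_filter, hfin.mem_toFinset, Set.mem_ofPred_eq, and_iff_right_iff_imp]
      exact fun h => h ▸ hm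
    have hσn : σ.Nonempty := ⟨m, (hσ m).2 rfl⟩
    have hxG : x ∈ G σ := fun c hc => by
      rw [(hσ c).1 hc]
      exact ⟨hm, fun d hd => (hmax d).lt_of_ne fun h => hd ((hσ d).2 h)⟩
    have hcard : σ.card < n + 2 := by
      by_contra! hle
      obtain ⟨T, hTσ, hT⟩ := Finset.exists_subset_card_eq hle
      refine (hord T hT ▸ Set.notMem_empty x : x ∉ _) (Set.mem_iInter₂.2 fun c hc => ?_)
      exact hρV c x (hxG c (hTσ hc)).1
    have hpos := hσn.card_pos
    let i : Fin (n + 1) := ⟨σ.card - 1, by omega⟩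
    exact ⟨i, hσn.choose i, Set.mem_iUnion.2 ⟨⟨σ, by simp only [i]; omega, hσn, rfl⟩, hxG⟩⟩

/-! ### Maps on simplices -/

/-- The closed simplex with vertex set `σ`, as the set of all barycentric coordinates: points of
`α → ℝ` (with the product topology) which are nonnegative, vanish outside `σ` and have total
mass `1`. All simplices with vertices in `α` thus lie in one space, a face in the simplex. -/
def simplexOn {α : Type*} (σ : Finset α) : Set (α → ℝ) :=
  {t | (∀ a, 0 ≤ t a) ∧ (∀ a ∉ σ, t a = 0) ∧ ∑ a ∈ σ, t a = 1}

section Simplices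

variable {α : Type*}

theorem simplexOn_of_support {σ τ : Finset α} (h : σ ⊆ τ) {t : α → ℝ} (ht : t ∈ simplexOn τ)
    (hσ : ∀ a ∉ σ, t a = 0) : t ∈ simplexOn σ := by
  refine ⟨ht.1, hσ, ?_⟩
  rw [← ht.2.2]
  exact Finset.sum_subset h fun a _ ha => hσ a ha

theorem simplexOn_nonempty_of_mem {σ : Finset α} {t : α → ℝ} (ht : t ∈ simplexOn σ) :
    σ.Nonempty := by
  rcases σ.eq_empty_or_nonempty with rfl | h
  · simpa using ht.2.2
  · exact h

theorem isClosed_simplexOn (σ : Finset α) : IsClosed (simplexOn σ) := by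
  have h : simplexOn σ = (⋂ a, {t : α → ℝ | 0 ≤ t a}) ∩ (⋂ a ∉ σ, {t : α → ℝ | t a = 0}) ∩
      {t | ∑ a ∈ σ, t a = 1} := by
    ext t
    simp [simplexOn, and_assoc]
  rw [h]
  refine ((isClosed_iInter fun a => isClosed_le continuous_const (continuous_apply a)).inter
    (isClosed_iInter fun a => isClosed_iInter fun _ =>
      isClosed_eq (continuous_apply a) continuous_const)).inter
    (isClosed_eq (continuous_finsetSum _ fun a _ => continuous_apply a) continuous_const)

theorem isCompact_simplexOn (σ : Finset α) : IsCompact (simplexOn σ) := by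
  refine (isCompact_univ_pi fun _ : α => isCompact_Icc (a := (0 : ℝ)) (b := 1)).of_isClosed_subset
    (isClosed_simplexOn σ) ?_
  rintro t ⟨h0, h1, h2⟩ a -
  refine ⟨h0 a, ?_⟩
  by_cases ha : a ∈ σ
  · exact h2 ▸ Finset.single_le_sum (fun b _ => h0 b) ha
  · exact (h1 a ha).trans_le zero_le_one

theorem subset_of_sphereExtends {Y : Type*} [TopologicalSpace Y] {k : ℕ} {S B : Set Y}
    (h : SphereExtends k S B) : S ⊆ B := by
  intro y hy
  obtain ⟨H, hHB, hH⟩ := h (ContinuousMap.const _ y) fun _ => hy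
  have hne : (Metric.sphere (0 : EuclideanSpace ℝ (Fin (k + 1))) 1).Nonempty :=
    NormedSpace.sphere_nonempty.2 zero_le_one
  obtain ⟨p, hp⟩ := hne
  have := hHB ⟨p, Metric.sphere_subset_closedBall hp⟩
  rwa [hH ⟨p, hp⟩] at this

/-- A simplex of dimension `j + 1` and the unit ball of `ℝ^(j+1)` are homeomorphic, by a map which
respects the boundaries: barycentric coordinates of an affine basis identify the simplex with a
convex body, and every convex body is homeomorphic to the ball. Only what the extension of maps
needs is recorded: a map `P` of the simplex to the ball, and a map `Q` which inverts it on the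
boundary. -/
theorem exists_simplexOn_ball {j : ℕ} {σ : Finset α} (hσ : σ.card = j + 2) :
    ∃ (P : (α → ℝ) → EuclideanSpace ℝ (Fin (j + 1))) (Q : EuclideanSpace ℝ (Fin (j + 1)) → α → ℝ),
      Continuous P ∧ Continuous Q ∧ Set.MapsTo P (simplexOn σ) (Metric.closedBall 0 1) ∧
      (∀ p ∈ Metric.sphere 0 1, Q p ∈ simplexOn σ ∧ ∃ a ∈ σ, Q p a = 0) ∧
      ∀ t ∈ simplexOn σ, (∃ a ∈ σ, t a = 0) → P t ∈ Metric.sphere 0 1 ∧ Q (P t) = t := by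
  classical
  obtain ⟨b⟩ : Nonempty (AffineBasis σ ℝ (EuclideanSpace ℝ (Fin (j + 1)))) :=
    AffineBasis.exists_affineBasis_of_finiteDimensional (by simp [hσ])
  let C : Set (EuclideanSpace ℝ (Fin (j + 1))) := convexHull ℝ (Set.range b)
  have hCint : interior C = {u | ∀ i, 0 < b.coord i u} := b.interior_convexHull
  have hC : C = {u | ∀ i, 0 ≤ b.coord i u} := b.convexHull_eq_nonneg_coord
  have hcoord : ∀ i, Continuous (b.coord i) := fun i => continuous_barycentric_coord b i
  have hCclosed : IsClosed C := by
    rw [hC, Set.ofPred_forall]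
    exact isClosed_iInter fun i => isClosed_le continuous_const (hcoord i)
  obtain ⟨Θ, -, hΘC, hΘS⟩ := exists_homeomorph_image_interior_closure_frontier_eq_unitBall
    (convex_convexHull ℝ (Set.range b)) ⟨_, b.centroid_mem_interior_convexHull⟩
    (isBounded_convexHull.2 (Set.finite_range b).isBounded)
  rw [hCclosed.closure_eq] at hΘC
  let P : (α → ℝ) → EuclideanSpace ℝ (Fin (j + 1)) := fun t => ∑ a : σ, t a • b a
  let Q : EuclideanSpace ℝ (Fin (j + 1)) → α → ℝ :=
    fun u a => if ha : a ∈ σ then b.coord ⟨a, ha⟩ u else 0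
  have hP : Continuous P := by fun_prop
  have hQ : Continuous Q := by
    refine continuous_pi fun a => ?_
    by_cases ha : a ∈ σ
    · simpa [Q, ha] using hcoord ⟨a, ha⟩
    · simpa [Q, ha] using continuous_const
  have hPcoord : ∀ t ∈ simplexOn σ, ∀ i : σ, b.coord i (P t) = t i := by
    intro t ht i
    have hsum : ∑ a : σ, t a = 1 := by rw [Finset.sum_coe_sort σ t]; exact ht.2.2
    have := b.coord_apply_combination_of_mem (Finset.mem_univ i) (w := fun a : σ => t a) hsum
    rwa [Finset.affineCombination_eq_linear_combination _ _ _ hsum] at this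
  have hPC : ∀ t ∈ simplexOn σ, P t ∈ C := fun t ht => by
    rw [hC]
    exact fun i => (hPcoord t ht i).symm ▸ ht.1 i
  have hQP : ∀ t ∈ simplexOn σ, Q (P t) = t := fun t ht => by
    funext a
    by_cases ha : a ∈ σ
    · simpa [Q, ha] using hPcoord t ht ⟨a, ha⟩
    · simpa [Q, ha] using (ht.2.1 a ha).symm
  have hQσ : ∀ u ∈ C, Q u ∈ simplexOn σ := fun u hu => by
    rw [hC] at hu
    refine ⟨fun a => ?_, fun a ha => by simp [Q, ha], ?_⟩
    · by_cases ha : a ∈ σ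
      · simpa [Q, ha] using hu ⟨a, ha⟩
      · simp [Q, ha]
    · rw [← Finset.sum_coe_sort σ (Q u), ← b.sum_coord_apply_eq_one u]
      exact Finset.sum_congr rfl fun a _ => by simp [Q]
  have hfront : ∀ u, u ∈ frontier C ↔ u ∈ C ∧ ∃ i, b.coord i u = 0 := fun u => by
    rw [hCclosed.frontier_eq, hCint]
    refine and_congr_right fun hu => ?_
    rw [hC] at hu
    simp only [Set.mem_ofPred_eq, not_forall, not_lt]
    exact exists_congr fun i => ⟨fun h => le_antisymm h (hu i), fun h => h.le⟩
  refine ⟨fun t => Θ (P t), fun p => Q (Θ.symm p), Θ.continuous.comp hP,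
    hQ.comp Θ.symm.continuous, fun t ht => hΘC ▸ Set.mem_image_of_mem Θ (hPC t ht), ?_, ?_⟩
  · intro p hp
    rw [← hΘS] at hp
    obtain ⟨u, hu, rfl⟩ := hp
    obtain ⟨huC, ⟨a, ha⟩, hi⟩ := (hfront u).1 hu
    beta_reduce
    rw [Θ.symm_apply_apply]
    exact ⟨hQσ u huC, a, ha, by simpa [Q, ha] using hi⟩
  · rintro t ht ⟨a, ha, hta⟩
    beta_reduce
    rw [Θ.symm_apply_apply]
    exact ⟨hΘS ▸ Set.mem_image_of_mem Θ ((hfront _).2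
      ⟨hPC t ht, ⟨a, ha⟩, (hPcoord t ht ⟨a, ha⟩).trans hta⟩), hQP t ht⟩

/-- Extension of a map from the boundary of a simplex of dimension `j + 1`. -/
theorem exists_extension_simplexOn {Y : Type*} [TopologicalSpace Y] {j : ℕ} {S B : Set Y}
    (hSB : SphereExtends j S B) {σ : Finset α} (hσ : σ.card = j + 2) {h : (α → ℝ) → Y}
    (hc : ∀ τ ⊂ σ, ContinuousOn h (simplexOn τ)) (hS : ∀ τ ⊂ σ, Set.MapsTo h (simplexOn τ) S) :
    ∃ e : (α → ℝ) → Y, ContinuousOn e (simplexOn σ) ∧ Set.MapsTo e (simplexOn σ) B ∧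
      ∀ t ∈ simplexOn σ, (∃ a ∈ σ, t a = 0) → e t = h t := by
  classical
  obtain ⟨P, Q, hP, hQ, hPσ, hQσ, hQP⟩ := exists_simplexOn_ball hσ
  have hhD : ContinuousOn h (⋃ a : σ, simplexOn (σ.erase a)) :=
    (locallyFinite_of_finite _).continuousOn_iUnion
      (fun a => isClosed_simplexOn _) fun a => hc _ (Finset.erase_ssubset a.2)
  have hQD : ∀ p ∈ Metric.sphere 0 1, ∃ a : σ, Q p ∈ simplexOn (σ.erase a) := fun p hp => by
    obtain ⟨hp, a, ha, h0⟩ := hQσ p hp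
    refine ⟨⟨a, ha⟩, simplexOn_of_support (σ.erase_subset _) hp fun c hc => ?_⟩
    by_cases hca : c = a
    · exact hca ▸ h0
    · exact hp.2.1 c fun h => hc (Finset.mem_erase.2 ⟨hca, h⟩)
  obtain ⟨H, hHB, hH⟩ := hSB
    ⟨fun p => h (Q p), hhD.comp_continuous (hQ.comp continuous_subtype_val)
      fun p => Set.mem_iUnion.2 (hQD p p.2)⟩
    fun p => by
      obtain ⟨a, ha⟩ := hQD p p.2
      exact hS _ (Finset.erase_ssubset a.2) ha
  refine ⟨fun t => if ht : t ∈ simplexOn σ then H ⟨P t, hPσ ht⟩ else h t, ?_, ?_, ?_⟩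
  · rw [continuousOn_iff_continuous_domRestrict]
    have hcont : Continuous fun t : simplexOn σ => H ⟨P t.1, hPσ t.2⟩ :=
      H.continuous.comp ((hP.comp continuous_subtype_val).subtype_mk _)
    refine hcont.congr fun t => ?_
    rw [Set.domRestrict_apply, dif_pos t.2]
  · intro t ht
    simpa [ht] using hHB ⟨P t, hPσ ht⟩
  · intro t ht hb
    obtain ⟨hs, hQPt⟩ := hQP t ht hb
    have := hH ⟨P t, hs⟩
    simp only [ContinuousMap.coe_mk, hQPt] at this
    simpa [ht] using this

/-- Extension over the simplices in `N`, by induction on the dimension; `A σ` is the set in which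
the simplex `σ` has to be mapped. The simplices outside `N`, on which the map `h` is kept, must form
a subcomplex. No finiteness is needed, since the open simplices are disjoint and the extensions over
simplices of the same dimension can be chosen at the same time. -/
theorem exists_extension_skeleta {Y : Type*} [TopologicalSpace Y] {N : Set (Finset α)}
    {A : Finset α → Set Y} {h : (α → ℝ) → Y}
    (hN : ∀ σ ∈ N, ∀ τ ⊆ σ, ∀ ρ ⊆ τ, ρ ∈ N → τ ∈ N)
    (hA0 : ∀ σ ∈ N, σ.card = 1 → (A σ).Nonempty)
    (hA : ∀ σ ∈ N, ∀ j, σ.card = j + 2 → ∃ S, SphereExtends j S (A σ) ∧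
      ∀ τ ⊂ σ, τ.Nonempty → (τ ∈ N → A τ ⊆ S) ∧
        (τ ∉ N → ContinuousOn h (simplexOn τ) ∧ Set.MapsTo h (simplexOn τ) S)) (m : ℕ) :
    ∃ e : (α → ℝ) → Y, (∀ t, (∀ σ ∈ N, ¬∀ a, a ∈ σ ↔ t a ≠ 0) → e t = h t) ∧
      ∀ σ ∈ N, σ.card ≤ m → ContinuousOn e (simplexOn σ) ∧ Set.MapsTo e (simplexOn σ) (A σ) := by
  classical
  induction m with
  | zero =>
    refine ⟨h, fun _ _ => rfl, fun σ _ hσ => ?_⟩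
    have : simplexOn σ = ∅ := Set.eq_empty_of_forall_notMem fun t ht =>
      (simplexOn_nonempty_of_mem ht).card_pos.not_ge hσ
    simp [this, Set.mapsTo_empty]
  | succ m ih =>
    obtain ⟨e, heh, he⟩ := ih
    have key : ∀ σ : {σ // σ ∈ N ∧ σ.card = m + 1}, ∃ f : (α → ℝ) → Y,
        ContinuousOn f (simplexOn σ.1) ∧ Set.MapsTo f (simplexOn σ.1) (A σ) ∧
        ∀ t ∈ simplexOn σ.1, (∃ a ∈ σ.1, t a = 0) → f t = e t := by
      rintro ⟨σ, hσ, hcard⟩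
      rcases m with _ | j
      · obtain ⟨y, hy⟩ := hA0 σ hσ hcard
        refine ⟨fun _ => y, continuousOn_const, fun _ _ => hy, ?_⟩
        rintro t ht ⟨a, ha, hta⟩
        obtain ⟨b, rfl⟩ := Finset.card_eq_one.1 hcard
        obtain rfl := Finset.mem_singleton.1 ha
        have := ht.2.2
        simp [hta] at this
      · obtain ⟨S, hS, hτ⟩ := hA σ hσ j hcard
        have hface : ∀ τ ⊂ σ, ContinuousOn e (simplexOn τ) ∧ Set.MapsTo e (simplexOn τ) S := by
          intro τ hτσ
          rcases τ.eq_empty_or_nonempty with rfl | hne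
          · have : simplexOn (∅ : Finset α) = ∅ := Set.eq_empty_of_forall_notMem fun t ht =>
              Finset.not_nonempty_empty (simplexOn_nonempty_of_mem ht)
            simp [this, Set.mapsTo_empty]
          have hlt := Finset.card_lt_card hτσ
          by_cases hτN : τ ∈ N
          · obtain ⟨h1, h2⟩ := he τ hτN (by omega)
            exact ⟨h1, h2.mono_right ((hτ τ hτσ hne).1 hτN)⟩
          · have heq : Set.EqOn e h (simplexOn τ) := fun t ht => heh t fun ρ hρ hsupp =>
              hτN (hN σ hσ τ hτσ.1 ρ (fun a ha => by
                by_contra haτ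
                exact (hsupp a).1 ha (ht.2.1 a haτ)) hρ)
            obtain ⟨h1, h2⟩ := (hτ τ hτσ hne).2 hτN
            exact ⟨h1.congr heq, h2.congr heq.symm⟩
        exact exists_extension_simplexOn hS hcard (fun τ h => (hface τ h).1)
          fun τ h => (hface τ h).2
    choose f hfc hfA hfe using key
    let e' : (α → ℝ) → Y := fun t =>
      if ht : ∃ σ : {σ // σ ∈ N ∧ σ.card = m + 1}, ∀ a, a ∈ σ.1 ↔ t a ≠ 0 then f ht.choose t
      else e t
    refine ⟨e', fun t ht => ?_, fun σ hσ hcard => ?_⟩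
    · have : ¬∃ σ : {σ // σ ∈ N ∧ σ.card = m + 1}, ∀ a, a ∈ σ.1 ↔ t a ≠ 0 :=
        fun ⟨σ, h⟩ => ht σ σ.2.1 h
      simp only [e', this, dif_neg, not_false_eq_true]
      exact heh t ht
    · rcases hcard.lt_or_eq with hlt | heq
      · have hee : Set.EqOn e' e (simplexOn σ) := fun t ht => by
          have : ¬∃ ρ : {σ // σ ∈ N ∧ σ.card = m + 1}, ∀ a, a ∈ ρ.1 ↔ t a ≠ 0 := by
            rintro ⟨ρ, hρ⟩
            have hρσ : ρ.1 ⊆ σ := fun a ha => by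
              by_contra haσ
              exact (hρ a).1 ha (ht.2.1 a haσ)
            have := Finset.card_le_card hρσ
            have := ρ.2.2
            omega
          exact dif_neg this
        obtain ⟨h1, h2⟩ := he σ hσ (by omega)
        exact ⟨h1.congr hee, h2.congr hee.symm⟩
      · have hef : Set.EqOn e' (f ⟨σ, hσ, heq⟩) (simplexOn σ) := fun t ht => by
          by_cases hex : ∃ ρ : {σ // σ ∈ N ∧ σ.card = m + 1}, ∀ a, a ∈ ρ.1 ↔ t a ≠ 0
          · have hρσ : hex.choose.1 ⊆ σ := fun a ha => by
              by_contra haσ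
              exact (hex.choose_spec a).1 ha (ht.2.1 a haσ)
            have : hex.choose = ⟨σ, hσ, heq⟩ := Subtype.ext
              (Finset.eq_of_subset_of_card_le hρσ (by rw [heq, hex.choose.2.2]))
            simp only [e', hex, dif_pos, this]
          · have hb : ∃ a ∈ σ, t a = 0 := by
              by_contra! hb
              exact hex ⟨⟨σ, hσ, heq⟩, fun a => ⟨hb a, fun ha => by
                by_contra haσ
                exact ha (ht.2.1 a haσ)⟩⟩
            rw [hfe ⟨σ, hσ, heq⟩ t ht hb]
            simp only [e', hex, dif_neg, not_false_eq_true]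
        exact ⟨(hfc _).congr hef, (hfA ⟨σ, hσ, heq⟩).congr hef.symm⟩

end Simplices

/-! ### Construction of selections -/

theorem subset_of_sphereExtends_of_le {X Y : Type*} [TopologicalSpace Y]
    {φ : ℕ → X → Set Y} {n : ℕ}
    (hext : ∀ i < n, ∀ x, SphereExtends i (φ i x) (φ (i + 1) x)) {i j : ℕ} (hij : i ≤ j)
    (hj : j ≤ n) (x : X) : φ i x ⊆ φ j x := by
  induction j, hij using Nat.le_induction with
  | base => exact subset_rfl
  | succ j _ ih => exact (ih (by omega)).trans (subset_of_sphereExtends (hext j (by omega) x))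

section Selections

variable {X Y : Type*} [TopologicalSpace X] [TopologicalSpace Y]

/-- The state of the construction after `k` steps, for a sequence of mappings `φ`. The vertices of
level `i` are the pairs `(i, s)` with `s : X`, and `F (i, s)` is a member of the `i`-th cover; only
the levels below `k` are in use. The nerve of these covers consists of the sets `σ` with at most one
vertex on each level such that the members of the covers indexed by `σ` have a common point, and
`h` is a map of its realization which takes a simplex `σ` of dimension `j` into `φ j x` for every
such common point `x`. -/
structure IsNerveSelection (φ : ℕ → X → Set Y) (k : ℕ) (F : ℕ × X → Set X)
    (h : (ℕ × X → ℝ) → Y) : Prop where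
  isClosed : ∀ a, a.1 < k → IsClosed (F a)
  locallyFinite : ∀ i < k, LocallyFinite fun s => F (i, s)
  cover : ∀ i < k, ∀ x, ∃ s, F (i, s) ∈ nhds x
  map : ∀ σ : Finset (ℕ × X), (∀ a ∈ σ, a.1 < k) → Set.InjOn Prod.fst (σ : Set (ℕ × X)) →
    ∀ x, (∀ a ∈ σ, x ∈ F a) →
      ContinuousOn h (simplexOn σ) ∧ Set.MapsTo h (simplexOn σ) (φ (σ.card - 1) x)

/-- Each point `x` becomes the apex `(k, x)` of a cone over the finite complex of those simplices
whose members of the covers contain `x`. The map extends over the cone with the simplices going to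
the values of `φ` at `x`, and by lower local constancy this remains so at the points of a
neighbourhood of `x`. These neighbourhoods are refined to the next cover. -/
theorem IsNerveSelection.exists_succ [T2Space X] [ParacompactSpace X] {φ : ℕ → X → Set Y} {n k : ℕ}
    (hk : k ≤ n) (hllc : ∀ i ≤ n, LowerLocallyConstant (φ i)) (hne : ∀ x, (φ 0 x).Nonempty)
    (hext : ∀ i < n, ∀ x, SphereExtends i (φ i x) (φ (i + 1) x))
    {F : ℕ × X → Set X} {h : (ℕ × X → ℝ) → Y} (hF : IsNerveSelection φ k F h) :
    ∃ F' h', IsNerveSelection φ (k + 1) F' h' := by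
  classical
  -- `IsCone x σ`: the simplex `σ` of the cone with apex `(k, x)` contains the apex.
  let IsCone : X → Finset (ℕ × X) → Prop := fun x σ => (k, x) ∈ σ ∧
    (∀ a ∈ σ, a ≠ (k, x) → a.1 < k ∧ x ∈ F a) ∧ Set.InjOn Prod.fst (σ : Set (ℕ × X))
  have hapex : ∀ {x σ}, IsCone x σ → ∀ x', (k, x') ∈ σ → x' = x := fun {x σ} hσ x' hx' => by
    by_contra hne
    exact lt_irrefl k (hσ.2.1 (k, x') hx' fun h => hne (Prod.ext_iff.1 h).2).1
  have hface : ∀ {x σ τ}, IsCone x σ → τ ⊆ σ → (k, x) ∈ τ → IsCone x τ := fun hσ hτ hx =>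
    ⟨hx, fun a ha => hσ.2.1 a (hτ ha), hσ.2.2.mono (Finset.coe_subset.2 hτ)⟩
  have hcardle : ∀ {x σ}, IsCone x σ → σ.card ≤ n + 1 := fun {x σ} hσ => by
    have := Finset.card_le_card_of_injOn (s := σ) (t := Finset.range (k + 1)) Prod.fst
      (fun a ha => by
        by_cases hax : a = (k, x)
        · simp [hax]
        · have := (hσ.2.1 a ha hax).1
          simp only [Finset.coe_range, Set.mem_Iio]
          omega) hσ.2.2
    rw [Finset.card_range] at this
    omega
  let A : Finset (ℕ × X) → Set Y := fun σ => {y | ∀ x, (k, x) ∈ σ → y ∈ φ (σ.card - 1) x}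
  have hA : ∀ {x σ}, IsCone x σ → A σ = φ (σ.card - 1) x := fun {x σ} hσ => by
    ext y
    refine ⟨fun hy => hy x hσ.1, fun hy x' hx' => ?_⟩
    rwa [hapex hσ x' hx']
  obtain ⟨e, heh, he⟩ := exists_extension_skeleta (N := {σ | ∃ x, IsCone x σ}) (A := A) (h := h)
    (by
      rintro σ ⟨x, hσ⟩ τ hτ ρ hρ ⟨x', hx'⟩
      obtain rfl := hapex hσ x' (hτ (hρ hx'.1))
      exact ⟨x', hface hσ hτ (hρ hx'.1)⟩)
    (by
      rintro σ ⟨x, hσ⟩ hcard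
      rw [hA hσ, hcard]
      exact hne x)
    (by
      rintro σ ⟨x, hσ⟩ j hcard
      have hcn := hcardle hσ
      refine ⟨φ j x, ?_, fun τ hτ hτne => ?_⟩
      · rw [hA hσ, hcard]
        exact hext j (by omega) x
      · have hlt := Finset.card_lt_card hτ
        have hsub : φ (τ.card - 1) x ⊆ φ j x :=
          subset_of_sphereExtends_of_le hext (by omega) (by omega) x
        refine ⟨?_, fun hτN => ?_⟩
        · rintro ⟨x', hx'⟩
          obtain rfl := hapex hσ x' (hτ.1 hx'.1)
          rwa [hA hx']
        · have hxτ : (k, x) ∉ τ := fun hx => hτN ⟨x, hface hσ hτ.1 hx⟩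
          have hτ' : ∀ a ∈ τ, a.1 < k ∧ x ∈ F a := fun a ha =>
            hσ.2.1 a (hτ.1 ha) fun hax => hxτ (hax ▸ ha)
          obtain ⟨h1, h2⟩ := hF.map τ (fun a ha => (hτ' a ha).1)
            (hσ.2.2.mono (Finset.coe_subset.2 hτ.1)) x fun a ha => (hτ' a ha).2
          exact ⟨h1, h2.mono_right hsub⟩)
    (n + 1)
  have hinsert : ∀ x (c : Finset (ℕ × X)), (∀ a ∈ c, a.1 < k ∧ x ∈ F a) →
      Set.InjOn Prod.fst (c : Set (ℕ × X)) →
      IsCone x (insert (k, x) c) ∧ (insert (k, x) c).card = c.card + 1 := fun x c hc hinj => by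
    have hx : (k, x) ∉ c := fun h => lt_irrefl k (hc _ h).1
    refine ⟨⟨Finset.mem_insert_self _ _, fun a ha hax =>
      hc a (Finset.mem_of_mem_insert_of_ne ha hax), ?_⟩, Finset.card_insert_of_notMem hx⟩
    rw [Finset.coe_insert, Set.injOn_insert (by exact_mod_cast hx)]
    refine ⟨hinj, ?_⟩
    rintro ⟨a, ha, hak⟩
    exact (hc a ha).1.ne hak
  let O : X → Set X := fun x => {x' | (∀ i < k, ∀ s, x' ∈ F (i, s) → x ∈ F (i, s)) ∧
    ∀ c : Finset (ℕ × X), ((∀ a ∈ c, a.1 < k ∧ x ∈ F a) ∧ Set.InjOn Prod.fst (c : Set (ℕ × X))) →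
      e '' simplexOn (insert (k, x) c) ⊆ φ c.card x'}
  have hO : ∀ x, O x ∈ nhds x := fun x => by
    have h1 : ∀ᶠ x' in nhds x, ∀ i ∈ Finset.range k, ∀ s, x' ∈ F (i, s) → x ∈ F (i, s) := by
      refine (Finset.eventually_all _).2 fun i hi => ?_
      have hi := Finset.mem_range.1 hi
      filter_upwards [(hF.locallyFinite i hi).iInter_compl_mem_nhds
        (fun s => hF.isClosed (i, s) hi) x] with x' hx' s hs
      by_contra hxs
      exact Set.mem_iInter₂.1 hx' s hxs hs
    have hfin : {a : ℕ × X | a.1 < k ∧ x ∈ F a}.Finite := by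
      refine ((Finset.range k).finite_toSet.biUnion (t := fun i => Prod.mk i '' {s | x ∈ F (i, s)})
        fun i hi => ((hF.locallyFinite i (Finset.mem_range.1 hi)).point_finite x).image _).subset ?_
      rintro ⟨i, s⟩ ⟨hi, hs⟩
      exact Set.mem_biUnion (Finset.mem_coe.2 (Finset.mem_range.2 hi)) ⟨s, hs, rfl⟩
    have hfin' : {c : Finset (ℕ × X) | (∀ a ∈ c, a.1 < k ∧ x ∈ F a) ∧
        Set.InjOn Prod.fst (c : Set (ℕ × X))}.Finite := by
      refine (Finset.finite_toSet hfin.toFinset.powerset).subset fun c hc => ?_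
      exact Finset.mem_coe.2 (Finset.mem_powerset.2 fun a ha => hfin.mem_toFinset.2 (hc.1 a ha))
    have h2 : ∀ᶠ x' in nhds x, ∀ c ∈ {c : Finset (ℕ × X) | (∀ a ∈ c, a.1 < k ∧ x ∈ F a) ∧
        Set.InjOn Prod.fst (c : Set (ℕ × X))}, e '' simplexOn (insert (k, x) c) ⊆ φ c.card x' := by
      refine (Filter.eventually_all_finite hfin').2 fun c hc => ?_
      obtain ⟨hcone, hcard⟩ := hinsert x c hc.1 hc.2
      have hcn := hcardle hcone
      obtain ⟨hcont, hmaps⟩ := he _ ⟨x, hcone⟩ hcn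
      rw [hA hcone, hcard] at hmaps
      have hK := (isCompact_simplexOn _).image_of_continuousOn hcont
      exact (hllc c.card (by omega) _ hK).mem_nhds hmaps.image_subset
    filter_upwards [h1, h2] with x' hx1 hx2
    exact ⟨fun i hi => hx1 i (Finset.mem_range.2 hi), hx2⟩
  obtain ⟨v, hvo, hv, hvf, hvO⟩ := precise_refinement (fun x => interior (O x))
    (fun x => isOpen_interior)
    (Set.eq_univ_of_forall fun x => Set.mem_iUnion.2 ⟨x, mem_interior_iff_mem_nhds.2 (hO x)⟩)
  obtain ⟨w, hw, hwo, hwv⟩ := exists_iUnion_eq_closure_subset hvo hvf.point_finite hv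
  let F' : ℕ × X → Set X := fun a => if a.1 = k then closure (w a.2) else F a
  have hF'k : ∀ s, F' (k, s) = closure (w s) := fun s => by simp [F']
  have hF'lt : ∀ a : ℕ × X, a.1 < k → F' a = F a := fun a ha => by simp [F', ha.ne]
  refine ⟨F', e, fun a ha => ?_, fun i hi => ?_, fun i hi x => ?_, fun σ hσk hinj x hx => ?_⟩
  · rcases (Nat.lt_succ_iff.1 ha).lt_or_eq with hlt | heq
    · rw [hF'lt a hlt]
      exact hF.isClosed a hlt
    · simp [F', heq]
  · rcases (Nat.lt_succ_iff.1 hi).lt_or_eq with hlt | rfl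
    · simp only [hF'lt (i, _) hlt]
      exact hF.locallyFinite i hlt
    · simp only [hF'k]
      exact hvf.subset hwv
  · rcases (Nat.lt_succ_iff.1 hi).lt_or_eq with hlt | rfl
    · simp only [hF'lt (i, _) hlt]
      exact hF.cover i hlt x
    · obtain ⟨s, hs⟩ := Set.mem_iUnion.1 (hw.symm ▸ Set.mem_univ x : x ∈ ⋃ s, w s)
      refine ⟨s, ?_⟩
      rw [hF'k]
      exact Filter.mem_of_superset ((hwo s).mem_nhds hs) subset_closure
  · by_cases hnew : ∃ s, (k, s) ∈ σ
    · obtain ⟨s, hs⟩ := hnew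
      have hlt : ∀ a ∈ σ.erase (k, s), a.1 < k := fun a ha => by
        obtain ⟨hne, haσ⟩ := Finset.mem_erase.1 ha
        exact (Nat.lt_succ_iff.1 (hσk a haσ)).lt_of_ne fun h => hne (hinj haσ hs h)
      have hxO : x ∈ O s := interior_subset (hvO s (hwv s (hF'k s ▸ hx _ hs)))
      have hc : ∀ a ∈ σ.erase (k, s), a.1 < k ∧ s ∈ F a := fun a ha =>
        ⟨hlt a ha, hxO.1 a.1 (hlt a ha) a.2
          (hF'lt a (hlt a ha) ▸ hx a (Finset.mem_of_mem_erase ha))⟩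
      have hcinj : Set.InjOn Prod.fst (σ.erase (k, s) : Set (ℕ × X)) :=
        hinj.mono (Finset.coe_subset.2 (σ.erase_subset _))
      obtain ⟨hcone, hcard⟩ := hinsert s _ hc hcinj
      have hsub := hxO.2 _ ⟨hc, hcinj⟩
      rw [Finset.insert_erase hs] at hcone hcard hsub
      refine ⟨(he σ ⟨s, hcone⟩ (hcardle hcone)).1, ?_⟩
      rw [hcard, Nat.add_sub_cancel]
      exact Set.mapsTo_iff_image_subset.2 hsub
    · have hlt : ∀ a ∈ σ, a.1 < k := fun a ha =>
        (Nat.lt_succ_iff.1 (hσk a ha)).lt_of_ne fun h => hnew ⟨a.2, h ▸ ha⟩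
      have heq : Set.EqOn e h (simplexOn σ) := fun t ht => heh t fun ρ ⟨s, hρ⟩ hsupp =>
        (hsupp (k, s)).1 hρ.1 (ht.2.1 _ fun hs => hnew ⟨s, hs⟩)
      obtain ⟨h1, h2⟩ := hF.map σ hlt hinj x fun a ha => hF'lt a (hlt a ha) ▸ hx a ha
      exact ⟨h1.congr heq, h2.congr heq.symm⟩

theorem exists_isNerveSelection [T2Space X] [ParacompactSpace X] [Nonempty X] {φ : ℕ → X → Set Y}
    {n : ℕ} (hllc : ∀ i ≤ n, LowerLocallyConstant (φ i)) (hne : ∀ x, (φ 0 x).Nonempty)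
    (hext : ∀ i < n, ∀ x, SphereExtends i (φ i x) (φ (i + 1) x)) :
    ∀ k ≤ n + 1, ∃ F h, IsNerveSelection φ k F h := by
  intro k hk
  induction k with
  | zero =>
    obtain ⟨x₀⟩ := ‹Nonempty X›
    obtain ⟨y, -⟩ := hne x₀
    refine ⟨fun _ => ∅, fun _ => y, by simp, by simp, by simp, fun σ hσ _ x _ =>
      ⟨continuousOn_const, fun t ht => ?_⟩⟩
    obtain ⟨a, ha⟩ := simplexOn_nonempty_of_mem ht
    exact absurd (hσ a ha) (Nat.not_lt_zero _)
  | succ k ih =>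
    obtain ⟨F, h, hF⟩ := ih (by omega)
    exact hF.exists_succ (by omega) hllc hne hext

/-- The selection theorem for sequences of lower locally constant mappings. The `n + 1` covers of a
nerve selection are refined by disjoint families `V i`, and a partition of unity `ρ` subordinate to
the unions of these families gives a map `T` of `X` to the nerve; locally it takes its values in one
simplex, since `x` belongs to at most one member of each family. -/
theorem CoveringDimLE.exists_selection [T2Space X] [ParacompactSpace X] {n : ℕ}
    (hX : CoveringDimLE X n) {φ : ℕ → X → Set Y}
    (hllc : ∀ i ≤ n, LowerLocallyConstant (φ i)) (hne : ∀ x, (φ 0 x).Nonempty)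
    (hext : ∀ i < n, ∀ x, SphereExtends i (φ i x) (φ (i + 1) x)) :
    ∃ f : X → Y, Continuous f ∧ IsSelection f (φ n) := by
  classical
  rcases isEmpty_or_nonempty X with hemp | hnonempty
  · exact ⟨fun x => (hemp.false x).elim, continuous_of_const fun x => (hemp.false x).elim,
      fun x => (hemp.false x).elim⟩
  obtain ⟨F, h, hF⟩ := exists_isNerveSelection hllc hne hext (n + 1) le_rfl
  obtain ⟨V, hVo, hVF, hVd, hV⟩ := hX.exists_disjoint_refinements
    (U := fun i s => interior (F (i, s))) (fun _ _ => isOpen_interior) fun i =>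
      Set.eq_univ_of_forall fun x => by
        obtain ⟨s, hs⟩ := hF.cover i i.2 x
        exact Set.mem_iUnion.2 ⟨s, mem_interior_iff_mem_nhds.2 hs⟩
  obtain ⟨ρ, hρ⟩ := PartitionOfUnity.exists_isSubordinate isClosed_univ (fun i => ⋃ s, V i s)
    (fun i => isOpen_iUnion (hVo i)) fun x _ => by
      obtain ⟨i, s, hx⟩ := hV x
      exact Set.mem_iUnion.2 ⟨i, Set.mem_iUnion.2 ⟨s, hx⟩⟩
  let l : ℕ × X → Fin (n + 1) := fun a => Fin.ofNat (n + 1) a.1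
  have hl : ∀ a : ℕ × X, a.1 < n + 1 → (l a : ℕ) = a.1 := fun a ha => Nat.mod_eq_of_lt ha
  let T : X → ℕ × X → ℝ := fun x a => if a.1 < n + 1 ∧ x ∈ V (l a) a.2 then ρ (l a) x else 0
  have hinj : ∀ x, Set.InjOn Prod.fst {a : ℕ × X | a.1 < n + 1 ∧ x ∈ V (l a) a.2} := by
    rintro x ⟨i, s⟩ ⟨-, hs⟩ ⟨j, t⟩ ⟨-, ht⟩ hij
    obtain rfl : i = j := hij
    by_contra hst
    exact Set.disjoint_left.1 (hVd _ fun h => hst (Prod.ext rfl h)) hs ht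
  have hfin : ∀ x, {a : ℕ × X | a.1 < n + 1 ∧ x ∈ V (l a) a.2}.Finite := fun x =>
    Set.Finite.of_injOn (fun a ha => ha.1) (hinj x) (Set.finite_Iio (n + 1))
  let σ : X → Finset (ℕ × X) := fun x => (hfin x).toFinset
  have hσ : ∀ x a, a ∈ σ x ↔ a.1 < n + 1 ∧ x ∈ V (l a) a.2 := fun x a => (hfin x).mem_toFinset
  have hloc : ∀ x, ∀ᶠ x' in nhds x, ∀ i : Fin (n + 1),
      (∀ s, x ∈ V i s → x' ∈ V i s) ∧ (x ∉ ⋃ s, V i s → ρ i x' = 0) := fun x => by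
    refine Filter.eventually_all.2 fun i => ?_
    by_cases hx : x ∈ ⋃ s, V i s
    · obtain ⟨s, hs⟩ := Set.mem_iUnion.1 hx
      filter_upwards [(hVo i s).mem_nhds hs] with x' hx'
      refine ⟨fun t ht => ?_, fun h => (h hx).elim⟩
      by_cases hst : s = t
      · exact hst ▸ hx'
      · exact (Set.disjoint_left.1 (hVd i hst) hs ht).elim
    · filter_upwards [notMem_tsupport_iff_eventuallyEq.1 fun h => hx (hρ i h)] with x' hx'
      exact ⟨fun s hs => (hx (Set.mem_iUnion.2 ⟨s, hs⟩)).elim, fun _ => hx'⟩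
  -- Near `x` the map `T` is given by the same formula on each vertex.
  have hT : ∀ x, ∀ᶠ x' in nhds x, (∀ a ∈ σ x, T x' a = ρ (l a) x') ∧ (∀ a ∉ σ x, T x' a = 0) ∧
      ∀ i, x ∉ ⋃ s, V i s → ρ i x' = 0 := fun x => by
    filter_upwards [hloc x] with x' hx'
    refine ⟨fun a ha => ?_, fun a ha => ?_, fun i => (hx' i).2⟩
    · obtain ⟨ha, hxa⟩ := (hσ x a).1 ha
      exact if_pos ⟨ha, (hx' _).1 _ hxa⟩
    · by_cases hcond : a.1 < n + 1 ∧ x' ∈ V (l a) a.2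
      · simp only [T, hcond, and_self, if_true]
        refine (hx' (l a)).2 fun hx => ?_
        obtain ⟨s, hs⟩ := Set.mem_iUnion.1 hx
        have hsa : s ≠ a.2 := fun h => ha ((hσ x a).2 ⟨hcond.1, h ▸ hs⟩)
        exact Set.disjoint_left.1 (hVd (l a) hsa) ((hx' _).1 s hs) hcond.2
      · exact if_neg hcond
  have hTσ : ∀ x, ∀ᶠ x' in nhds x, T x' ∈ simplexOn (σ x) := fun x => by
    filter_upwards [hT x] with x' ⟨h1, h2, h3⟩
    refine ⟨fun a => ?_, h2, ?_⟩
    · by_cases ha : a ∈ σ x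
      · exact (h1 a ha).symm ▸ ρ.nonneg _ _
      · exact (h2 a ha).ge
    · have hsum := ρ.sum_eq_one (Set.mem_univ x')
      rw [finsum_eq_sum_of_fintype] at hsum
      rw [← hsum]
      refine Finset.sum_of_injOn l (fun a ha b hb hab => ?_)
        (fun _ _ => Finset.mem_coe.2 (Finset.mem_univ _)) (fun i _ hi => h3 i fun hx => ?_) h1
      · have ha' := (hσ x a).1 ha
        have hb' := (hσ x b).1 hb
        exact hinj x ha' hb' (by rw [← hl a ha'.1, ← hl b hb'.1, hab])
      · obtain ⟨s, hs⟩ := Set.mem_iUnion.1 hx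
        have hli : l (i, s) = i := Fin.ext (hl (i, s) i.2)
        exact hi ⟨(i, s), (hσ x _).2 ⟨i.2, hli.symm ▸ hs⟩, hli⟩
  have hTc : ∀ x, ContinuousAt T x := fun x => by
    refine continuousAt_pi.2 fun a => ?_
    by_cases ha : a ∈ σ x
    · refine (ρ (l a)).continuous.continuousAt.congr ?_
      filter_upwards [hT x] with x' hx' using (hx'.1 a ha).symm
    · refine (continuousAt_const (y := (0 : ℝ))).congr ?_
      filter_upwards [hT x] with x' hx' using (hx'.2.1 a ha).symm
  have hmap : ∀ x, ContinuousOn h (simplexOn (σ x)) ∧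
      Set.MapsTo h (simplexOn (σ x)) (φ ((σ x).card - 1) x) := fun x => by
    refine hF.map (σ x) (fun a ha => ((hσ x a).1 ha).1) ?_ x fun a ha => ?_
    · rw [(hfin x).coe_toFinset]
      exact hinj x
    · obtain ⟨ha, hxa⟩ := (hσ x a).1 ha
      have := interior_subset (hVF _ _ hxa)
      rwa [hl a ha] at this
  have hcard : ∀ x, (σ x).card ≤ n + 1 := fun x => by
    have := Finset.card_le_card_of_injOn (s := σ x) (t := Finset.range (n + 1)) Prod.fst
      (fun a ha => Finset.mem_coe.2 (Finset.mem_range.2 ((hσ x a).1 ha).1))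
      (by rw [(hfin x).coe_toFinset]; exact hinj x)
    rwa [Finset.card_range] at this
  refine ⟨fun x => h (T x), continuous_iff_continuousAt.2 fun x => ?_, fun x => ?_⟩
  · exact ((hmap x).1 _ (hTσ x).self_of_nhds).tendsto.comp
      (tendsto_nhdsWithin_iff.2 ⟨hTc x, hTσ x⟩)
  · have := hcard x
    exact subset_of_sphereExtends_of_le hext (by omega) le_rfl x
      ((hmap x).2 (hTσ x).self_of_nhds)

end Selections

/-- A compact subset of an open ball stays in the ball when the centre moves a little. -/
theorem LowerLocallyConstant.ball_inter {X Y : Type*} [TopologicalSpace X] [PseudoMetricSpace Y]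
    {ψ : X → Set Y} (hψ : LowerLocallyConstant ψ) {g : X → Y} (hg : Continuous g) (r : ℝ) :
    LowerLocallyConstant fun x => Metric.ball (g x) r ∩ ψ x := by
  intro K hK
  have h : {x | K ⊆ Metric.ball (g x) r ∩ ψ x} =
      {x | ∀ y ∈ K, dist y (g x) < r} ∩ {x | K ⊆ ψ x} := by
    ext x
    exact Set.subset_inter_iff
  rw [h]
  refine IsOpen.inter (isOpen_iff_mem_nhds.2 fun x hx => ?_) (hψ K hK)
  refine hK.eventually_forall_of_forall_eventually fun y hy => ?_
  have hcont : Continuous fun p : X × Y => dist p.2 (g p.1) := by fun_prop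
  exact hcont.continuousAt.eventually_lt_const (hx y hy)

theorem theorem4p2 {X Y : Type*} [TopologicalSpace X] [T2Space X] [ParacompactSpace X]
    [MetricSpace Y] (n : ℕ) (hX : CoveringDimLE X n)
    (δ : Set.Ioi (0 : ℝ) → Set.Ioi (0 : ℝ))
    (ψ : Fin (n + 1) → X → Set Y)
    (hne : ∀ k x, (ψ k x).Nonempty)
    (hllc : ∀ k, LowerLocallyConstant (ψ k))
    (hext : ∀ (ε : Set.Ioi (0 : ℝ)) (x : X) (y : Y) (k : Fin n),
      SphereExtends (k : ℕ) (Metric.ball y (δ ε : ℝ) ∩ ψ k.castSucc x)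
        (Metric.ball y (ε : ℝ) ∩ ψ k.succ x))
    (ε : Set.Ioi (0 : ℝ)) (g : X → Y) (hg : Continuous g)
    (hgsel : IsApproxSelection (δ^[n] ε : ℝ) g (ψ 0)) :
    ∃ f : X → Y, Continuous f ∧ IsSelection f (ψ (Fin.last n)) ∧
      ∀ x, dist (f x) (g x) < (ε : ℝ) := by
  let φ : ℕ → X → Set Y := fun k x =>
    Metric.ball (g x) (δ^[n - k] ε : ℝ) ∩ ψ (Fin.ofNat (n + 1) k) x
  obtain ⟨f, hf, hfφ⟩ := hX.exists_selection (φ := φ)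
    (fun k _ => (hllc _).ball_inter hg _)
    (fun x => by
      obtain ⟨y, hy, hgy⟩ := Set.mem_iUnion₂.1 (hgsel x)
      exact ⟨y, Metric.mem_ball_comm.1 hgy, hy⟩)
    (fun k hk x => by
      have h := hext (δ^[n - (k + 1)] ε) x (g x) ⟨k, hk⟩
      rw [← Function.iterate_succ_apply' δ, show (n - (k + 1)).succ = n - k by omega] at h
      have h1 : Fin.castSucc ⟨k, hk⟩ = Fin.ofNat (n + 1) k :=
        Fin.ext (Nat.mod_eq_of_lt (by omega : k < n + 1)).symm
      have h2 : Fin.succ ⟨k, hk⟩ = Fin.ofNat (n + 1) (k + 1) :=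
        Fin.ext (Nat.mod_eq_of_lt (by omega : k + 1 < n + 1)).symm
      rwa [h1, h2] at h)
  have hlast : Fin.ofNat (n + 1) n = Fin.last n := Fin.ext (Nat.mod_eq_of_lt n.lt_succ_self)
  refine ⟨f, hf, fun x => hlast ▸ (hfφ x).2, fun x => ?_⟩
  have := (hfφ x).1
  rwa [Nat.sub_self] at this
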